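/- Let $\Bbbk$ be an algebraically closed field of characteristic $0$, $G$ a finite abelian group with character group $A=\operatorname{Hom}(G,\Bbbk^\times)$, and $\beta:G\times G\to\Bbbk^\times$ a non-degenerate bicharacter. Let $\chi,\chi^o:G\to A$ be the group isomorphisms $\chi_g(h)=\beta(h,g)$ and $\chi^o_h(g)=\beta(h,g)$. Let $\theta\ge 0$, $\mathbb I=\{1,\dots,\theta\}$, let $\mathbf q=(q_{ij})_{i,j\in\mathbb I}$ be a matrix with entries in $\Bbbk^\times$ such that $q_{ii}\neq 1$ for all $i$, and let $t_i\in G$ for $i\in\mathbb I$. Put $\xi_i=\chi_{t_i}\in A$ and $\widetilde q_{ij}=\beta(t_i,t_j)^{-1}q_{ij}$. Let $\Gamma_0$, $\Lambda_0$ be free abelian groups with bases $(K_i)_{i\in\mathbb I}$, $(L_i)_{i\in\mathbb I}$, and $\Gamma=\Gamma_0\times G$, $\Lambda=\Lambda_0\times A$. Let $D(\mathcal E)$ be the Hopf algebra presented by the group $\Gamma\times\Lambda$ and generators $E_i,F_i$ $(i\in\mathbb I)$, with the following relations: the relations defining the Nichols algebra of the braided vector space with basis $(E_i)$ and braiding $c(E_i\otimes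 E_j)=q_{ij}E_j\otimes E_i$; those defining the Nichols algebra of the braided vector space with basis $(F_i)$ and braiding $c(F_i\otimes F_j)=q_{ji}F_j\otimes F_i$; and, for $i,j\in\mathbb I$, $t\in G$, $\xi\in A$, $$K_iE_jK_i^{-1}=\widetilde q_{ij}E_j,\quad K_iF_jK_i^{-1}=\widetilde q_{ij}^{\,-1}F_j,\quad L_iE_jL_i^{-1}=\widetilde q_{ji}^{\,-1}E_j,\quad L_iF_jL_i^{-1}=\widetilde q_{ji}F_j,$$ $$tE_jt^{-1}=\beta(t,t_j)E_j,\quad tF_jt^{-1}=\beta(t,t_j)^{-1}F_j,\quad \xi E_j\xi^{-1}=\xi(t_j)^{-1}E_j,\quad \xi F_j\xi^{-1}=\xi(t_j)F_j,$$ $$E_iF_j-F_jE_i=\delta_{ij}(t_iK_i-\xi_iL_i).$$ The elements of $\Gamma\times\Lambda$ are group-like, $\Delta(E_i)=E_i\otimes 1+K_it_i\otimes E_i$ and $\Delta(F_i)=F_i\otimes L_i\xi_i+1\otimes F_i$. For $t\in G$ the element $t\chi^o_t$ of $D(\mathcal E)$ is central; let $U(\mathcal E)$ be the quotient Hopf algebra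 of $D(\mathcal E)$ by the ideal generated by the elements $t\chi^o_t-1$, $t\in G$. Then the canonical Hopf algebra map $\Bbbk G\to U(\mathcal E)$ is injective, and there is a one-to-one correspondence between 1. group homomorphisms $\overline\pi:\Gamma_0\to G$, and 2. Hopf algebra retractions $\pi:U(\mathcal E)\to\Bbbk G$ of $\Bbbk G\hookrightarrow U(\mathcal E)$, under which $\overline\pi$ corresponds to the map $\pi$ determined by $$\pi(t)=t\ (t\in G),\qquad \pi(K_i)=\overline\pi(K_i),\qquad \pi(L_i)=t_i\,\overline\pi(K_i)\,(\chi^o)^{-1}(\xi_i),\qquad \pi(E_i)=\pi(F_i)=0\qquad(i\in\mathbb I).$$ -/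

import Mathlib

open scoped TensorProduct

noncomputable section

/-! ## Nichols algebras of diagonal type -/

namespace NicholsDiag

variable {k ι : Type*} [Field k]

/-- The action of the group-like element attached to the `i`-th basis vector on the tensor
algebra `T(V)` of the vector space with basis `(x_j)`: the algebra automorphism
`x_j ↦ q_{ij} x_j`. The braiding of `V` is `c(x_i ⊗ x_j) = q_{ij} x_j ⊗ x_i`. -/
def act (q : ι → ι → kˣ) (i : ι) : FreeAlgebra k ι →ₐ[k] FreeAlgebra k ι :=
  FreeAlgebra.lift k fun j => (q i j : k) • FreeAlgebra.ι k j

/-- Left multiplication by `x_i ⊗ 1 + 1 ⊗ x_i` in the braided tensor square of `T(V)`: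
`a ⊗ b ↦ x_i a ⊗ b + (g_i · a) ⊗ x_i b`. -/
def comulStep (q : ι → ι → kˣ) (i : ι) :
    Module.End k (FreeAlgebra k ι ⊗[k] FreeAlgebra k ι) :=
  TensorProduct.map (LinearMap.mulLeft k (FreeAlgebra.ι k i)) LinearMap.id +
    TensorProduct.map (act q i).toLinearMap (LinearMap.mulLeft k (FreeAlgebra.ι k i))

/-- The braided comultiplication of `T(V)`: the algebra map from `T(V)` to the braided tensor
square of `T(V)` with `x_i ↦ x_i ⊗ 1 + 1 ⊗ x_i`. -/
def comul (q : ι → ι → kˣ) :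
    FreeAlgebra k ι →ₗ[k] FreeAlgebra k ι ⊗[k] FreeAlgebra k ι :=
  (LinearMap.applyₗ (1 ⊗ₜ[k] 1)).comp (FreeAlgebra.lift k (comulStep q)).toLinearMap

/-- The operator `a ↦ -(g_i · a) x_i`. -/
def antipodeStep (q : ι → ι → kˣ) (i : ι) : Module.End k (FreeAlgebra k ι) :=
  -((LinearMap.mulRight k (FreeAlgebra.ι k i)).comp (act q i).toLinearMap)

/-- The braided antipode of `T(V)`: `S(1) = 1` and `S(x_i a) = -(g_i · S(a)) x_i`. -/
def antipode (q : ι → ι → kˣ) : FreeAlgebra k ι →ₗ[k] FreeAlgebra k ι :=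
  (LinearMap.applyₗ 1).comp (FreeAlgebra.lift k (antipodeStep q)).toLinearMap

/-- The noncommutative monomial `x_{i_1} ⋯ x_{i_n}`. -/
def word (k : Type*) {ι : Type*} [Field k] (l : List ι) : FreeAlgebra k ι :=
  (l.map (FreeAlgebra.ι k)).prod

/-- The component of `T(V)` of multidegree `m`. -/
def component (k : Type*) {ι : Type*} [Field k] (m : Multiset ι) :
    Submodule k (FreeAlgebra k ι) :=
  Submodule.span k {x | ∃ l : List ι, (l : Multiset ι) = m ∧ x = word k l}

/-- Two-sided ideals of `T(V)` which are generated by multihomogeneous elements of total degree at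
least two and are Hopf ideals of the braided Hopf algebra `T(V)`. The counit vanishes on such an
ideal automatically. -/
structure IsHomogeneousHopfIdeal (q : ι → ι → kˣ) (I : TwoSidedIdeal (FreeAlgebra k ι)) :
    Prop where
  exists_generators : ∃ s : Set (FreeAlgebra k ι),
    (∀ x ∈ s, ∃ m : Multiset ι, 2 ≤ Multiset.card m ∧ x ∈ component k m) ∧
      I = TwoSidedIdeal.span s
  comul_mem : ∀ x ∈ I, comul q x ∈
    LinearMap.range (LinearMap.lTensor (FreeAlgebra k ι)
      (I.asIdeal.restrictScalars k).subtype) ⊔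
    LinearMap.range (LinearMap.rTensor (FreeAlgebra k ι)
      (I.asIdeal.restrictScalars k).subtype)
  antipode_mem : ∀ x ∈ I, antipode q x ∈ I

/-- The ideal `I(V)` of `T(V)` defining the Nichols algebra `B(V) = T(V) / I(V)` of the braided
vector space of diagonal type with braiding matrix `q`: the sum of all homogeneous Hopf ideals of
`T(V)` generated in degrees at least two. -/
def nicholsIdeal (q : ι → ι → kˣ) : TwoSidedIdeal (FreeAlgebra k ι) :=
  sSup {I | IsHomogeneousHopfIdeal q I}

/-! ### Consequences used to define the comultiplication and antipode of the double -/

section aux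

variable {Q : Type*} [Ring Q] [Algebra k Q] {q : ι → ι → kˣ}

@[simp] lemma word_nil : word k ([] : List ι) = 1 := rfl

@[simp] lemma word_cons (i : ι) (l : List ι) :
    word k (i :: l) = FreeAlgebra.ι k i * word k l := by simp [word]

lemma comul_eq (x : FreeAlgebra k ι) :
    comul q x = FreeAlgebra.lift k (comulStep q) x (1 ⊗ₜ[k] 1) := rfl

lemma antipode_word_cons (i : ι) (l : List ι) :
    antipode q (word k (i :: l)) =
      -(act q i (antipode q (word k l)) * FreeAlgebra.ι k i) := by
  simp [antipode, antipodeStep]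

lemma antipode_one : antipode q (1 : FreeAlgebra k ι) = 1 := by
  simp [antipode]

lemma map_eq_zero (φ : FreeAlgebra k ι →ₐ[k] Q)
    (h : ∀ I, IsHomogeneousHopfIdeal q I → ∀ m : Multiset ι, ∀ x ∈ component k m, x ∈ I →
      φ x = 0) {x : FreeAlgebra k ι} (hx : x ∈ nicholsIdeal q) : φ x = 0 := by
  have : nicholsIdeal q ≤ TwoSidedIdeal.ker φ := by
    refine sSup_le fun I hI => ?_
    obtain ⟨s, hs, rfl⟩ := hI.exists_generators
    rw [TwoSidedIdeal.span_le]
    intro y hy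
    obtain ⟨m, -, hm⟩ := hs y hy
    exact (TwoSidedIdeal.mem_ker φ).2 (h _ hI m y hm (TwoSidedIdeal.subset_span hy))
  exact (TwoSidedIdeal.mem_ker φ).1 (this hx)

lemma mem_nicholsIdeal {I : TwoSidedIdeal (FreeAlgebra k ι)} (hI : IsHomogeneousHopfIdeal q I)
    {x : FreeAlgebra k ι} (hx : x ∈ I) : x ∈ nicholsIdeal q :=
  le_sSup (a := I) (s := {I | IsHomogeneousHopfIdeal q I}) hI hx

lemma act_comm (x u : ι → Q) (hux : ∀ i j, u i * x j = (q i j : k) • (x j * u i)) (i : ι)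
    (a : FreeAlgebra k ι) :
    u i * FreeAlgebra.lift k x a = FreeAlgebra.lift k x (act q i a) * u i := by
  induction a using FreeAlgebra.induction with
  | grade0 r => simp [Algebra.commutes]
  | grade1 j => simp [act, hux]
  | mul a b ha hb => rw [map_mul, map_mul, map_mul, ← mul_assoc, ha, mul_assoc, hb, mul_assoc]
  | add a b ha hb => simp [mul_add, add_mul, ha, hb]

lemma prod_perm {M : Type*} [Monoid M] {u : ι → M} (hu : ∀ i j, u i * u j = u j * u i)
    {l l' : List ι} (h : l.Perm l') : (l.map u).prod = (l'.map u).prod := by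
  refine (h.map u).prod_eq' ?_
  refine List.pairwise_of_forall_mem_list ?_
  intro a ha b hb
  obtain ⟨i, -, rfl⟩ := List.mem_map.1 ha
  obtain ⟨j, -, rfl⟩ := List.mem_map.1 hb
  exact hu i j

lemma comul_map_eq_zero (x u : ι → Q) (hux : ∀ i j, u i * x j = (q i j : k) • (x j * u i))
    (hu : ∀ i j, u i * u j = u j * u i)
    (hx : ∀ a ∈ nicholsIdeal q, FreeAlgebra.lift k x a = 0)
    {a : FreeAlgebra k ι} (ha : a ∈ nicholsIdeal q) :
    FreeAlgebra.lift k (fun i => x i ⊗ₜ[k] (1 : Q) + u i ⊗ₜ[k] x i) a = 0 := by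
  set f := FreeAlgebra.lift k x with hf
  set δ' := FreeAlgebra.lift k (fun i => u i ⊗ₜ[k] x i) with hδ'
  set δ := FreeAlgebra.lift k (fun i => x i ⊗ₜ[k] (1 : Q) + u i ⊗ₜ[k] x i) with hδ
  -- `δ'` on words
  have hword : ∀ l : List ι, δ' (word k l) = (l.map u).prod ⊗ₜ[k] f (word k l) := by
    intro l
    induction l with
    | nil => simp [Algebra.TensorProduct.one_def]
    | cons i l ih =>
      rw [word_cons, map_mul, map_mul, ih, hδ', hf, FreeAlgebra.lift_ι_apply,
        FreeAlgebra.lift_ι_apply, Algebra.TensorProduct.tmul_mul_tmul, List.map_cons,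
        List.prod_cons]
  have hδ'0 : ∀ b ∈ nicholsIdeal q, δ' b = 0 := by
    intro b hb
    refine map_eq_zero (q := q) δ' ?_ hb
    intro I hI m y hy hyI
    obtain ⟨l₀, rfl⟩ := Quot.exists_rep m
    have : ∀ y ∈ component k (Quot.mk _ l₀ : Multiset ι),
        δ' y = (l₀.map u).prod ⊗ₜ[k] f y := by
      intro y hy
      induction hy using Submodule.span_induction with
      | mem y hy =>
        obtain ⟨l, hl, rfl⟩ := hy
        rw [hword, prod_perm hu (Multiset.coe_eq_coe.1 hl)]
      | zero => simp
      | add a b _ _ ha hb => simp [ha, hb, TensorProduct.tmul_add]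
      | smul r a _ ha => simp [ha]
    rw [this y hy, hx y (mem_nicholsIdeal hI hyI), TensorProduct.tmul_zero]
  let θ : FreeAlgebra k ι ⊗[k] FreeAlgebra k ι →ₗ[k] Q ⊗[k] Q :=
    TensorProduct.lift ((LinearMap.mul k (Q ⊗[k] Q)).compl₁₂
      ((Algebra.TensorProduct.includeLeft : Q →ₐ[k] Q ⊗[k] Q).comp f).toLinearMap
      δ'.toLinearMap)
  have hθ : ∀ a b, θ (a ⊗ₜ b) = (f a ⊗ₜ[k] (1 : Q)) * δ' b := fun a b => rfl
  have key : ∀ a : FreeAlgebra k ι, ∀ z,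
      δ a * θ z = θ (FreeAlgebra.lift k (comulStep q) a z) := by
    intro a
    induction a using FreeAlgebra.induction with
    | grade0 r => intro z; simp [Algebra.smul_def, Module.algebraMap_end_apply]
    | grade1 i =>
      intro z
      induction z using TensorProduct.induction_on with
      | zero => simp
      | add a b ha hb => simp only [map_add, mul_add, ha, hb]
      | tmul a b =>
        have h1 : u i * f a = f (act q i a) * u i := act_comm x u hux i a
        simp only [hδ, FreeAlgebra.lift_ι_apply, comulStep, LinearMap.add_apply,
          TensorProduct.map_tmul, map_add, hθ, LinearMap.mulLeft_apply, LinearMap.id_apply,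
          AlgHom.toLinearMap_apply, map_mul, add_mul]
        rw [← mul_assoc, ← mul_assoc, ← mul_assoc]
        have h2 : f (FreeAlgebra.ι k i) = x i := FreeAlgebra.lift_ι_apply _ _
        have h3 : δ' (FreeAlgebra.ι k i) = u i ⊗ₜ[k] x i := FreeAlgebra.lift_ι_apply _ _
        simp only [h2, h3, Algebra.TensorProduct.tmul_mul_tmul, one_mul, mul_one, h1]
    | mul a b ha hb => intro z; rw [map_mul, mul_assoc, hb, ha, map_mul]; rfl
    | add a b ha hb => intro z; simp [add_mul, ha, hb]
  have hcomul : ∀ a, δ a = θ (comul q a) := by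
    intro a
    rw [comul_eq, ← key, hθ]
    simp [← Algebra.TensorProduct.one_def]
  refine map_eq_zero (q := q) δ ?_ ha
  intro I hI m y _ hyI
  have h0 := hI.comul_mem y hyI
  have hle : LinearMap.range (LinearMap.lTensor (FreeAlgebra k ι)
      (I.asIdeal.restrictScalars k).subtype) ⊔
    LinearMap.range (LinearMap.rTensor (FreeAlgebra k ι)
      (I.asIdeal.restrictScalars k).subtype) ≤ LinearMap.ker θ := by
    refine sup_le ?_ ?_ <;> rw [LinearMap.range_le_ker_iff] <;>
      refine TensorProduct.ext' fun a b => ?_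
    · have : (b : FreeAlgebra k ι) ∈ nicholsIdeal q := mem_nicholsIdeal hI b.2
      simp [hθ, hδ'0 _ this]
    · have : (a : FreeAlgebra k ι) ∈ nicholsIdeal q := mem_nicholsIdeal hI a.2
      simp [hθ, hx _ this]
  rw [hcomul]
  exact hle h0

lemma antipode_map_eq_zero (x u v : ι → Q)
    (hux : ∀ i j, u i * x j = (q i j : k) • (x j * u i))
    (hv : ∀ i j, v i * v j = v j * v i) (huv : ∀ i, u i * v i = 1) (hvu : ∀ i, v i * u i = 1)
    (hx : ∀ a ∈ nicholsIdeal q, FreeAlgebra.lift k x a = 0)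
    {a : FreeAlgebra k ι} (ha : a ∈ nicholsIdeal q) :
    FreeAlgebra.lift k (fun i => MulOpposite.op (-(v i * x i))) a = 0 := by
  set f := FreeAlgebra.lift k x with hf
  set σ := FreeAlgebra.lift k (fun i => MulOpposite.op (-(v i * x i))) with hσ
  have hvf : ∀ i a, v i * f (act q i a) = f a * v i := by
    intro i a
    have h1 : u i * f a = f (act q i a) * u i := act_comm x u hux i a
    calc v i * f (act q i a) = v i * (f (act q i a) * u i) * v i := by
          rw [mul_assoc, mul_assoc, huv, mul_one]
      _ = f a * v i := by rw [← h1, ← mul_assoc, hvu, one_mul]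
  have hword : ∀ l : List ι, (σ (word k l)).unop = (l.map v).prod * f (antipode q (word k l)) := by
    intro l
    induction l with
    | nil => simp [antipode_one]
    | cons i l ih =>
      have hc : (l.map v).prod * v i = v i * (l.map v).prod := by
        have := prod_perm hv (List.perm_append_singleton i l)
        simpa using this
      rw [antipode_word_cons, word_cons, map_mul, MulOpposite.unop_mul, ih]
      simp only [hσ, FreeAlgebra.lift_ι_apply, MulOpposite.unop_op, map_neg, map_mul,
        List.map_cons, List.prod_cons, mul_neg]
      have h2 : f (FreeAlgebra.ι k i) = x i := FreeAlgebra.lift_ι_apply _ _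
      rw [← hc, h2, mul_assoc _ (v i), ← mul_assoc (v i) (f _), hvf]
      simp [mul_assoc]
  refine map_eq_zero (q := q) σ ?_ ha
  intro I hI m y hy hyI
  obtain ⟨l₀, rfl⟩ := Quot.exists_rep m
  have : ∀ y ∈ component k (Quot.mk _ l₀ : Multiset ι),
      (σ y).unop = (l₀.map v).prod * f (antipode q y) := by
    intro y hy
    induction hy using Submodule.span_induction with
    | mem y hy =>
      obtain ⟨l, hl, rfl⟩ := hy
      rw [hword, prod_perm hv (Multiset.coe_eq_coe.1 hl)]
    | zero => simp
    | add a b _ _ ha hb => simp [ha, hb, mul_add]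
    | smul r a _ ha => simp [ha]
  apply MulOpposite.unop_injective
  rw [this y hy, hx _ (mem_nicholsIdeal hI (hI.antipode_mem y hyI))]
  simp

/-- The scalar relating the antipodes for the braiding and for its inverse. -/
def ratio (q : ι → ι → kˣ) : List ι → kˣ
  | [] => 1
  | i :: l => (l.map fun j => (q i j * q j i)⁻¹).prod * ratio q l

lemma ratio_perm {l l' : List ι} (h : l.Perm l') : ratio q l = ratio q l' := by
  induction h with
  | nil => rfl
  | cons i h ih => simp only [ratio, ih, (h.map _).prod_eq]
  | swap i j l => simp only [ratio, List.map_cons, List.prod_cons, mul_comm (q j i)]; ac_rfl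
  | trans _ _ h₁ h₂ => exact h₁.trans h₂

lemma act_antipode_word (i : ι) (l : List ι) :
    act q i (antipode q (word k l)) =
      (((l.map fun j => q i j).prod : kˣ) : k) • antipode q (word k l) := by
  induction l generalizing i with
  | nil => simp [antipode_one]
  | cons j l ih =>
    rw [antipode_word_cons, ih, map_neg, map_mul, map_smul, ih]
    simp only [act, FreeAlgebra.lift_ι_apply, List.map_cons, List.prod_cons, Units.val_mul,
      smul_mul_assoc, mul_smul_comm, smul_neg, smul_smul]
    congr 2
    ring

lemma antipode_cop_map_eq_zero (x u v : ι → Q)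
    (hux : ∀ i j, u i * x j = (q i j : k) • (x j * u i))
    (hv : ∀ i j, v i * v j = v j * v i) (huv : ∀ i, u i * v i = 1) (hvu : ∀ i, v i * u i = 1)
    (hx : ∀ a ∈ nicholsIdeal q, FreeAlgebra.lift k x a = 0)
    {a : FreeAlgebra k ι} (ha : a ∈ nicholsIdeal q) :
    FreeAlgebra.lift k (fun i => MulOpposite.op (-(x i * v i))) a = 0 := by
  set f := FreeAlgebra.lift k x with hf
  set σ := FreeAlgebra.lift k (fun i => MulOpposite.op (-(x i * v i))) with hσ
  have hvx : ∀ i j, v i * x j = (((q i j)⁻¹ : kˣ) : k) • (x j * v i) := by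
    intro i j
    have h1 : x j * v i = (q i j : k) • (v i * x j) := by
      calc x j * v i = v i * (u i * x j) * v i := by rw [← mul_assoc, hvu, one_mul]
        _ = (q i j : k) • (v i * x j) := by
          rw [hux, mul_smul_comm, smul_mul_assoc, mul_assoc, mul_assoc, huv, mul_one]
    rw [h1, smul_smul]
    simp
  have hVx : ∀ (l : List ι) j, (l.map v).prod * x j =
      (((l.map fun i => (q i j)⁻¹).prod : kˣ) : k) • (x j * (l.map v).prod) := by
    intro l j
    induction l with
    | nil => simp
    | cons i l ih =>
      simp only [List.map_cons, List.prod_cons, Units.val_mul]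
      rw [mul_assoc, ih, mul_smul_comm, ← mul_assoc, hvx, smul_mul_assoc, smul_smul, mul_assoc,
        mul_comm (Units.val _)]
  have hword : ∀ l : List ι, (σ (word k l)).unop =
      (ratio q l : k) • (f (antipode q (word k l)) * (l.map v).prod) := by
    intro l
    induction l with
    | nil => simp [antipode_one, ratio]
    | cons i l ih =>
      have hc : (l.map v).prod * v i = v i * (l.map v).prod := by
        have := prod_perm hv (List.perm_append_singleton i l)
        simpa using this
      have hr : ((ratio q (i :: l) : kˣ) : k) * (((l.map fun j => q i j).prod : kˣ) : k) =
          (ratio q l : k) * (((l.map fun j => (q j i)⁻¹).prod : kˣ) : k) := by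
        rw [← Units.val_mul, ← Units.val_mul]
        congr 1
        rw [ratio, mul_right_comm, ← List.prod_map_mul, mul_comm]
        congr 3
        funext j
        rw [mul_inv, mul_comm, mul_inv_cancel_left]
      rw [antipode_word_cons, word_cons, map_mul, MulOpposite.unop_mul, ih, act_antipode_word]
      simp only [hσ, FreeAlgebra.lift_ι_apply, MulOpposite.unop_op, map_neg, map_mul, map_smul,
        List.map_cons, List.prod_cons, mul_neg, neg_mul, smul_mul_assoc, smul_neg, smul_smul]
      rw [hr, ← hc]
      congr 1
      rw [mul_assoc (f _), ← mul_assoc _ (x i), hVx, smul_mul_assoc, mul_smul_comm, smul_smul]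
      simp [hf, mul_assoc]
  refine map_eq_zero (q := q) σ ?_ ha
  intro I hI m y hy hyI
  obtain ⟨l₀, rfl⟩ := Quot.exists_rep m
  have : ∀ y ∈ component k (Quot.mk _ l₀ : Multiset ι),
      (σ y).unop = (ratio q l₀ : k) • (f (antipode q y) * (l₀.map v).prod) := by
    intro y hy
    induction hy using Submodule.span_induction with
    | mem y hy =>
      obtain ⟨l, hl, rfl⟩ := hy
      have hp := Multiset.coe_eq_coe.1 hl
      rw [hword, prod_perm hv hp, ratio_perm hp]
    | zero => simp
    | add a b _ _ ha hb => simp [ha, hb, add_mul]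
    | smul r a _ ha =>
      simp only [map_smul, MulOpposite.unop_smul, ha, smul_mul_assoc]
      rw [smul_comm]
  apply MulOpposite.unop_injective
  rw [this y hy, hx _ (mem_nicholsIdeal hI (hI.antipode_mem y hyI))]
  simp

end aux

end NicholsDiag

/-! ## The quantum double attached to a datum -/

/-- A datum for the construction of a quantum double: a matrix `q`, abelian groups `Γ` and `Λ`,
elements `g_i ∈ Γ` and characters `γ_j` of `Γ` with `γ_j(g_i) = q_{ij}`, elements `h_i ∈ Λ` and
characters `λ_j` of `Λ` with `λ_j(h_i) = q_{ji}`, and a bimultiplicative form `μ : Γ × Λ → kˣ`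
with `μ(g_i, h_j) = q_{ij}`. -/
structure DoubleDatum (k ι Γ Λ : Type*) [Field k] [CommGroup Γ] [CommGroup Λ] where
  q : ι → ι → kˣ
  g : ι → Γ
  γ : ι → (Γ →* kˣ)
  h : ι → Λ
  lam : ι → (Λ →* kˣ)
  μ : Γ →* Λ →* kˣ
  γ_g : ∀ i j, γ j (g i) = q i j
  lam_h : ∀ i j, lam j (h i) = q j i
  μ_g_h : ∀ i j, μ (g i) (h j) = q i j

namespace DoubleDatum

variable {k ι Γ Λ : Type*} [Field k] [CommGroup Γ] [CommGroup Λ]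

/-- The generators of the quantum double. -/
inductive Gen (ι Γ Λ : Type*)
  | g : Γ → Gen ι Γ Λ
  | h : Λ → Gen ι Γ Λ
  | E : ι → Gen ι Γ Λ
  | F : ι → Gen ι Γ Λ

/-- The free algebra on the generators of the quantum double. -/
abbrev Free (k ι Γ Λ : Type*) [Field k] := FreeAlgebra k (Gen ι Γ Λ)

/-- A generator as an element of the free algebra. -/
abbrev gen (k : Type*) {ι Γ Λ : Type*} [Field k] (x : Gen ι Γ Λ) : Free k ι Γ Λ :=
  FreeAlgebra.ι k x

/-- The defining relations of the quantum double. -/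
inductive Rel (𝓔 : DoubleDatum k ι Γ Λ) : Free k ι Γ Λ → Free k ι Γ Λ → Prop
  -- the relations of the group `Γ × Λ`
  | g_one : Rel 𝓔 (gen k (.g 1)) 1
  | g_mul (a b : Γ) : Rel 𝓔 (gen k (.g (a * b))) (gen k (.g a) * gen k (.g b))
  | h_one : Rel 𝓔 (gen k (.h 1)) 1
  | h_mul (a b : Λ) : Rel 𝓔 (gen k (.h (a * b))) (gen k (.h a) * gen k (.h b))
  | g_h (a : Γ) (b : Λ) : Rel 𝓔 (gen k (.g a) * gen k (.h b)) (gen k (.h b) * gen k (.g a))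
  -- the relations between the group `Γ × Λ` and the generators `E_i`, `F_i`
  | g_E (a : Γ) (i : ι) : Rel 𝓔 (gen k (.g a) * gen k (.E i))
      ((𝓔.γ i a : k) • (gen k (.E i) * gen k (.g a)))
  | h_E (b : Λ) (i : ι) : Rel 𝓔 (gen k (.h b) * gen k (.E i))
      ((((𝓔.μ (𝓔.g i) b)⁻¹ : kˣ) : k) • (gen k (.E i) * gen k (.h b)))
  | h_F (b : Λ) (i : ι) : Rel 𝓔 (gen k (.h b) * gen k (.F i))
      ((𝓔.lam i b : k) • (gen k (.F i) * gen k (.h b)))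
  | g_F (a : Γ) (i : ι) : Rel 𝓔 (gen k (.g a) * gen k (.F i))
      ((((𝓔.μ a (𝓔.h i))⁻¹ : kˣ) : k) • (gen k (.F i) * gen k (.g a)))
  -- `E_i F_j - F_j E_i = δ_{ij} (g_i - h_i)`
  | E_F_self (i : ι) : Rel 𝓔 (gen k (.E i) * gen k (.F i) - gen k (.F i) * gen k (.E i))
      (gen k (.g (𝓔.g i)) - gen k (.h (𝓔.h i)))
  | E_F_of_ne (i j : ι) (hij : i ≠ j) :
      Rel 𝓔 (gen k (.E i) * gen k (.F j) - gen k (.F j) * gen k (.E i)) 0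
  -- the relations of the Nichols algebras of `V` (basis `E_i`) and `W` (basis `F_i`); the braiding
  -- matrices are `γ_j(g_i) = q_{ij}` and `λ_j(h_i) = q_{ji}`
  | nichols_E (x : FreeAlgebra k ι) (hx : x ∈ NicholsDiag.nicholsIdeal 𝓔.q) :
      Rel 𝓔 (FreeAlgebra.lift k (fun i => gen k (.E i)) x) 0
  | nichols_F (x : FreeAlgebra k ι) (hx : x ∈ NicholsDiag.nicholsIdeal fun i j => 𝓔.q j i) :
      Rel 𝓔 (FreeAlgebra.lift k (fun i => gen k (.F i)) x) 0

/-- The quantum double `D(𝓔)`, as an algebra: generated by `Γ`, `Λ`, the `E_i` and the `F_i`, with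
the above relations. Its Hopf algebra structure is given below. -/
def D (𝓔 : DoubleDatum k ι Γ Λ) := RingQuot (Rel 𝓔)

variable (𝓔 : DoubleDatum k ι Γ Λ)

instance : Ring (D 𝓔) := inferInstanceAs (Ring (RingQuot (Rel 𝓔)))

instance : Algebra k (D 𝓔) := inferInstanceAs (Algebra k (RingQuot (Rel 𝓔)))

/-- The projection from the free algebra. -/
def toD : Free k ι Γ Λ →ₐ[k] D 𝓔 := RingQuot.mkAlgHom k (Rel 𝓔)

/-- The element of `D(𝓔)` given by an element of `Γ`. -/
def gD (a : Γ) : D 𝓔 := toD 𝓔 (gen k (.g a))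

/-- The element of `D(𝓔)` given by an element of `Λ`. -/
def hD (b : Λ) : D 𝓔 := toD 𝓔 (gen k (.h b))

/-- The generator `E_i` of `D(𝓔)`. -/
def ED (i : ι) : D 𝓔 := toD 𝓔 (gen k (.E i))

/-- The generator `F_i` of `D(𝓔)`. -/
def FD (i : ι) : D 𝓔 := toD 𝓔 (gen k (.F i))

/-! ### The relations, and maps out of the double -/

variable {𝓔}

lemma toD_rel {x y : Free k ι Γ Λ} (h : Rel 𝓔 x y) : toD 𝓔 x = toD 𝓔 y :=
  RingQuot.mkAlgHom_rel k h

@[simp] lemma gD_one : gD 𝓔 1 = 1 := by simpa [gD] using toD_rel (𝓔 := 𝓔) .g_one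

lemma gD_mul (a b : Γ) : gD 𝓔 (a * b) = gD 𝓔 a * gD 𝓔 b := by
  simpa [gD] using toD_rel (𝓔 := 𝓔) (.g_mul a b)

@[simp] lemma hD_one : hD 𝓔 1 = 1 := by simpa [hD] using toD_rel (𝓔 := 𝓔) .h_one

lemma hD_mul (a b : Λ) : hD 𝓔 (a * b) = hD 𝓔 a * hD 𝓔 b := by
  simpa [hD] using toD_rel (𝓔 := 𝓔) (.h_mul a b)

lemma gD_hD (a : Γ) (b : Λ) : gD 𝓔 a * hD 𝓔 b = hD 𝓔 b * gD 𝓔 a := by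
  simpa [hD, gD] using toD_rel (𝓔 := 𝓔) (.g_h a b)

lemma gD_ED (a : Γ) (i : ι) : gD 𝓔 a * ED 𝓔 i = (𝓔.γ i a : k) • (ED 𝓔 i * gD 𝓔 a) := by
  simpa [ED, gD] using toD_rel (𝓔 := 𝓔) (.g_E a i)

lemma hD_ED (b : Λ) (i : ι) :
    hD 𝓔 b * ED 𝓔 i = (((𝓔.μ (𝓔.g i) b)⁻¹ : kˣ) : k) • (ED 𝓔 i * hD 𝓔 b) := by
  simpa [ED, hD] using toD_rel (𝓔 := 𝓔) (.h_E b i)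

lemma hD_FD (b : Λ) (i : ι) : hD 𝓔 b * FD 𝓔 i = (𝓔.lam i b : k) • (FD 𝓔 i * hD 𝓔 b) := by
  simpa [FD, hD] using toD_rel (𝓔 := 𝓔) (.h_F b i)

lemma gD_FD (a : Γ) (i : ι) :
    gD 𝓔 a * FD 𝓔 i = (((𝓔.μ a (𝓔.h i))⁻¹ : kˣ) : k) • (FD 𝓔 i * gD 𝓔 a) := by
  simpa [FD, gD] using toD_rel (𝓔 := 𝓔) (.g_F a i)

lemma ED_FD_self (i : ι) :
    ED 𝓔 i * FD 𝓔 i - FD 𝓔 i * ED 𝓔 i = gD 𝓔 (𝓔.g i) - hD 𝓔 (𝓔.h i) := by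
  simpa [FD, ED, gD, hD] using toD_rel (𝓔 := 𝓔) (.E_F_self i)

lemma ED_FD_of_ne {i j : ι} (hij : i ≠ j) : ED 𝓔 i * FD 𝓔 j - FD 𝓔 j * ED 𝓔 i = 0 := by
  simpa [FD, ED] using toD_rel (𝓔 := 𝓔) (.E_F_of_ne i j hij)

lemma comp_lift {B C X : Type*} [Semiring B] [Algebra k B] [Semiring C] [Algebra k C]
    (φ : B →ₐ[k] C) (f : X → B) (x : FreeAlgebra k X) :
    φ (FreeAlgebra.lift k f x) = FreeAlgebra.lift k (fun i => φ (f i)) x := by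
  have : φ.comp (FreeAlgebra.lift k f) = FreeAlgebra.lift k (fun i => φ (f i)) := by
    ext; simp
  exact DFunLike.congr_fun this x

lemma nichols_ED (x : FreeAlgebra k ι) (hx : x ∈ NicholsDiag.nicholsIdeal 𝓔.q) :
    FreeAlgebra.lift k (ED 𝓔) x = 0 := by
  have := toD_rel (𝓔 := 𝓔) (.nichols_E x hx)
  rwa [comp_lift, map_zero] at this

lemma nichols_FD (x : FreeAlgebra k ι) (hx : x ∈ NicholsDiag.nicholsIdeal fun i j => 𝓔.q j i) :
    FreeAlgebra.lift k (FD 𝓔) x = 0 := by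
  have := toD_rel (𝓔 := 𝓔) (.nichols_F x hx)
  rwa [comp_lift, map_zero] at this

/-- An algebra map from the double is given by images of the generators satisfying the
defining relations. -/
def liftD {B : Type*} [Semiring B] [Algebra k B] (f : Gen ι Γ Λ → B)
    (hf : ∀ ⦃x y⦄, Rel 𝓔 x y → FreeAlgebra.lift k f x = FreeAlgebra.lift k f y) : D 𝓔 →ₐ[k] B :=
  RingQuot.liftAlgHom k ⟨FreeAlgebra.lift k f, hf⟩

lemma liftD_toD {B : Type*} [Semiring B] [Algebra k B] (f : Gen ι Γ Λ → B)
    (hf : ∀ ⦃x y⦄, Rel 𝓔 x y → FreeAlgebra.lift k f x = FreeAlgebra.lift k f y)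
    (x : Free k ι Γ Λ) : liftD f hf (toD 𝓔 x) = FreeAlgebra.lift k f x :=
  RingQuot.liftAlgHom_mkAlgHom_apply k _ _ _

lemma toD_surjective : Function.Surjective (toD 𝓔) := RingQuot.mkAlgHom_surjective k _

lemma algHom_ext {B : Type*} [Semiring B] [Algebra k B] {φ ψ : D 𝓔 →ₐ[k] B}
    (hg : ∀ a, φ (gD 𝓔 a) = ψ (gD 𝓔 a)) (hh : ∀ b, φ (hD 𝓔 b) = ψ (hD 𝓔 b))
    (hE : ∀ i, φ (ED 𝓔 i) = ψ (ED 𝓔 i)) (hF : ∀ i, φ (FD 𝓔 i) = ψ (FD 𝓔 i)) : φ = ψ := by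
  have h : φ.comp (toD 𝓔) = ψ.comp (toD 𝓔) := by
    ext x
    cases x with
    | g a => exact hg a
    | h b => exact hh b
    | E i => exact hE i
    | F i => exact hF i
  ext x
  obtain ⟨x, rfl⟩ := toD_surjective x
  exact DFunLike.congr_fun h x

/-! ### The Hopf algebra structure -/

/-- The comultiplication on generators: `Γ × Λ` is group-like,
`Δ(E_i) = E_i ⊗ 1 + g_i ⊗ E_i`, `Δ(F_i) = F_i ⊗ h_i + 1 ⊗ F_i`. -/
def comulGen (𝓔 : DoubleDatum k ι Γ Λ) : Gen ι Γ Λ → D 𝓔 ⊗[k] D 𝓔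
  | .g a => gD 𝓔 a ⊗ₜ gD 𝓔 a
  | .h b => hD 𝓔 b ⊗ₜ hD 𝓔 b
  | .E i => ED 𝓔 i ⊗ₜ 1 + gD 𝓔 (𝓔.g i) ⊗ₜ ED 𝓔 i
  | .F i => FD 𝓔 i ⊗ₜ hD 𝓔 (𝓔.h i) + 1 ⊗ₜ FD 𝓔 i

/-- The counit on generators. -/
def counitGen : Gen ι Γ Λ → k
  | .g _ => 1
  | .h _ => 1
  | .E _ => 0
  | .F _ => 0

/-- The antipode on generators: `S(g) = g⁻¹`, `S(h) = h⁻¹`, `S(E_i) = -g_i⁻¹ E_i`,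
`S(F_i) = -F_i h_i⁻¹`. -/
def antipodeGen (𝓔 : DoubleDatum k ι Γ Λ) : Gen ι Γ Λ → (D 𝓔)ᵐᵒᵖ
  | .g a => .op (gD 𝓔 a⁻¹)
  | .h b => .op (hD 𝓔 b⁻¹)
  | .E i => .op (-(gD 𝓔 (𝓔.g i)⁻¹ * ED 𝓔 i))
  | .F i => .op (-(FD 𝓔 i * hD 𝓔 (𝓔.h i)⁻¹))

lemma gD_comm (a b : Γ) : gD 𝓔 a * gD 𝓔 b = gD 𝓔 b * gD 𝓔 a := by
  rw [← gD_mul, mul_comm, gD_mul]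

lemma hD_comm (a b : Λ) : hD 𝓔 a * hD 𝓔 b = hD 𝓔 b * hD 𝓔 a := by
  rw [← hD_mul, mul_comm, hD_mul]

@[simp] lemma gD_mul_inv (a : Γ) : gD 𝓔 a * gD 𝓔 a⁻¹ = 1 := by rw [← gD_mul]; simp

@[simp] lemma gD_inv_mul (a : Γ) : gD 𝓔 a⁻¹ * gD 𝓔 a = 1 := by rw [← gD_mul]; simp

@[simp] lemma hD_mul_inv (a : Λ) : hD 𝓔 a * hD 𝓔 a⁻¹ = 1 := by rw [← hD_mul]; simp

@[simp] lemma hD_inv_mul (a : Λ) : hD 𝓔 a⁻¹ * hD 𝓔 a = 1 := by rw [← hD_mul]; simp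

lemma gE_q (i j : ι) : gD 𝓔 (𝓔.g i) * ED 𝓔 j =
    (𝓔.q i j : k) • (ED 𝓔 j * gD 𝓔 (𝓔.g i)) := by rw [gD_ED, 𝓔.γ_g]

lemma hF_q (i j : ι) : hD 𝓔 (𝓔.h i) * FD 𝓔 j =
    (𝓔.q j i : k) • (FD 𝓔 j * hD 𝓔 (𝓔.h i)) := by rw [hD_FD, 𝓔.lam_h]

lemma comul_EF (i j : ι) :
    comulGen 𝓔 (.E i) * comulGen 𝓔 (.F j) - comulGen 𝓔 (.F j) * comulGen 𝓔 (.E i) =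
      (ED 𝓔 i * FD 𝓔 j - FD 𝓔 j * ED 𝓔 i) ⊗ₜ[k] hD 𝓔 (𝓔.h j) +
        gD 𝓔 (𝓔.g i) ⊗ₜ[k] (ED 𝓔 i * FD 𝓔 j - FD 𝓔 j * ED 𝓔 i) := by
  simp only [comulGen, mul_add, add_mul, Algebra.TensorProduct.tmul_mul_tmul, one_mul, mul_one,
    gD_FD, hD_ED, TensorProduct.sub_tmul, TensorProduct.tmul_sub, TensorProduct.smul_tmul]
  abel

lemma comulGen_rel ⦃x y : Free k ι Γ Λ⦄ (h : Rel 𝓔 x y) :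
    FreeAlgebra.lift k (comulGen 𝓔) x = FreeAlgebra.lift k (comulGen 𝓔) y := by
  cases h with
  | g_one => simp [comulGen, Algebra.TensorProduct.one_def]
  | g_mul a b => simp [comulGen, gD_mul]
  | h_one => simp [comulGen, Algebra.TensorProduct.one_def]
  | h_mul a b => simp [comulGen, hD_mul]
  | g_h a b => simp [comulGen, gD_hD]
  | g_E a i =>
    simp [comulGen, gD_ED, mul_add, add_mul, gD_comm a, TensorProduct.smul_tmul]
  | h_E b i =>
    simp [comulGen, hD_ED, mul_add, add_mul, ← gD_hD, TensorProduct.smul_tmul]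
  | h_F b i =>
    simp [comulGen, hD_FD, mul_add, add_mul, hD_comm b, TensorProduct.smul_tmul]
  | g_F a i =>
    simp [comulGen, gD_FD, mul_add, add_mul, gD_hD, TensorProduct.smul_tmul]
  | E_F_self i =>
    simp only [map_sub, map_mul, FreeAlgebra.lift_ι_apply]
    rw [comul_EF, ED_FD_self]
    simp [comulGen, TensorProduct.sub_tmul, TensorProduct.tmul_sub]
  | E_F_of_ne i j hij =>
    simp only [map_sub, map_mul, FreeAlgebra.lift_ι_apply]
    rw [comul_EF, ED_FD_of_ne hij]
    simp
  | nichols_E x hx =>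
    rw [comp_lift, map_zero]
    simp only [FreeAlgebra.lift_ι_apply]
    exact NicholsDiag.comul_map_eq_zero (q := 𝓔.q) (ED 𝓔) (fun i => gD 𝓔 (𝓔.g i)) gE_q
      (fun _ _ => gD_comm _ _) nichols_ED hx
  | nichols_F x hx =>
    rw [comp_lift, map_zero]
    simp only [FreeAlgebra.lift_ι_apply]
    have := NicholsDiag.comul_map_eq_zero (q := fun i j => 𝓔.q j i) (FD 𝓔)
      (fun i => hD 𝓔 (𝓔.h i)) hF_q (fun _ _ => hD_comm _ _) nichols_FD hx
    have := congrArg (Algebra.TensorProduct.comm k (D 𝓔) (D 𝓔)).toAlgHom this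
    rw [comp_lift, map_zero] at this
    rw [← this]
    congr 2
    funext i
    simp [comulGen, add_comm]

lemma lift_zero_nichols {q : ι → ι → kˣ} {x : FreeAlgebra k ι}
    (hx : x ∈ NicholsDiag.nicholsIdeal q) :
    FreeAlgebra.lift k (fun _ : ι => (0 : k)) x = 0 := by
  have : NicholsDiag.nicholsIdeal q ≤
      TwoSidedIdeal.ker (FreeAlgebra.lift k (fun _ : ι => (0 : k))) := by
    refine sSup_le fun I hI => ?_
    obtain ⟨s, hs, rfl⟩ := hI.exists_generators
    rw [TwoSidedIdeal.span_le]
    intro y hy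
    obtain ⟨m, hm2, hm⟩ := hs y hy
    have hle : NicholsDiag.component k m ≤
        LinearMap.ker (FreeAlgebra.lift k (fun _ : ι => (0 : k))).toLinearMap := by
      refine Submodule.span_le.2 ?_
      rintro _ ⟨l, rfl, rfl⟩
      cases l with
      | nil => simp at hm2
      | cons i l => simp
    exact (TwoSidedIdeal.mem_ker _).2 (hle hm)
  exact (TwoSidedIdeal.mem_ker _).1 (this hx)

lemma counitGen_rel ⦃x y : Free k ι Γ Λ⦄ (h : Rel 𝓔 x y) :
    FreeAlgebra.lift k (counitGen : Gen ι Γ Λ → k) x =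
      FreeAlgebra.lift k (counitGen : Gen ι Γ Λ → k) y := by
  cases h with
  | nichols_E x hx =>
    rw [comp_lift, map_zero]
    simpa [counitGen] using lift_zero_nichols hx
  | nichols_F x hx =>
    rw [comp_lift, map_zero]
    simpa [counitGen] using lift_zero_nichols hx
  | _ => simp [counitGen]

lemma antipode_EF (i j : ι) :
    antipodeGen 𝓔 (.E i) * antipodeGen 𝓔 (.F j) - antipodeGen 𝓔 (.F j) * antipodeGen 𝓔 (.E i) =
      .op (-(gD 𝓔 (𝓔.g i)⁻¹ * (ED 𝓔 i * FD 𝓔 j - FD 𝓔 j * ED 𝓔 i) * hD 𝓔 (𝓔.h j)⁻¹)) := by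
  have h1 : FD 𝓔 j * hD 𝓔 (𝓔.h j)⁻¹ * (gD 𝓔 (𝓔.g i)⁻¹ * ED 𝓔 i) =
      gD 𝓔 (𝓔.g i)⁻¹ * (FD 𝓔 j * ED 𝓔 i) * hD 𝓔 (𝓔.h j)⁻¹ := by
    calc FD 𝓔 j * hD 𝓔 (𝓔.h j)⁻¹ * (gD 𝓔 (𝓔.g i)⁻¹ * ED 𝓔 i)
        = FD 𝓔 j * gD 𝓔 (𝓔.g i)⁻¹ * (hD 𝓔 (𝓔.h j)⁻¹ * ED 𝓔 i) := by
          rw [mul_assoc, ← mul_assoc (hD 𝓔 _), ← gD_hD]; simp only [mul_assoc]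
      _ = gD 𝓔 (𝓔.g i)⁻¹ * (FD 𝓔 j * ED 𝓔 i) * hD 𝓔 (𝓔.h j)⁻¹ := by
          rw [hD_ED, mul_assoc (gD 𝓔 _), mul_assoc (FD 𝓔 _) (ED 𝓔 _), ← mul_assoc (gD 𝓔 _), gD_FD]
          simp [mul_assoc]
  simp only [antipodeGen, ← MulOpposite.op_mul, ← MulOpposite.op_sub, neg_mul_neg]
  rw [h1]
  congr 1
  simp only [mul_sub, sub_mul, mul_assoc]
  abel

lemma antipodeGen_rel ⦃x y : Free k ι Γ Λ⦄ (h : Rel 𝓔 x y) :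
    FreeAlgebra.lift k (antipodeGen 𝓔) x = FreeAlgebra.lift k (antipodeGen 𝓔) y := by
  cases h with
  | g_one => simp [antipodeGen]
  | g_mul a b => simp [antipodeGen, ← MulOpposite.op_mul, gD_mul, gD_comm]
  | h_one => simp [antipodeGen]
  | h_mul a b => simp [antipodeGen, ← MulOpposite.op_mul, hD_mul, hD_comm]
  | g_h a b => simp [antipodeGen, ← MulOpposite.op_mul, gD_hD]
  | g_E a i =>
    simp only [map_mul, map_smul, FreeAlgebra.lift_ι_apply, antipodeGen,
      ← MulOpposite.op_mul, ← MulOpposite.op_smul]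
    congr 1
    rw [neg_mul, mul_neg, smul_neg, ← mul_assoc (gD 𝓔 a⁻¹), gD_comm a⁻¹, mul_assoc, mul_assoc,
      gD_ED, mul_smul_comm, smul_smul]
    simp
  | h_E b i =>
    simp only [map_mul, map_smul, FreeAlgebra.lift_ι_apply, antipodeGen,
      ← MulOpposite.op_mul, ← MulOpposite.op_smul]
    congr 1
    rw [neg_mul, mul_neg, smul_neg, ← mul_assoc (hD 𝓔 b⁻¹), ← gD_hD, mul_assoc, mul_assoc,
      hD_ED, mul_smul_comm, smul_smul]
    simp
  | h_F b i =>
    simp only [map_mul, map_smul, FreeAlgebra.lift_ι_apply, antipodeGen,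
      ← MulOpposite.op_mul, ← MulOpposite.op_smul]
    congr 1
    rw [neg_mul, mul_neg, smul_neg, mul_assoc, hD_comm _ b⁻¹, ← mul_assoc, ← mul_assoc,
      hD_FD, smul_mul_assoc, smul_smul]
    simp
  | g_F a i =>
    simp only [map_mul, map_smul, FreeAlgebra.lift_ι_apply, antipodeGen,
      ← MulOpposite.op_mul, ← MulOpposite.op_smul]
    congr 1
    rw [neg_mul, mul_neg, smul_neg, mul_assoc, ← gD_hD, ← mul_assoc, ← mul_assoc,
      gD_FD, smul_mul_assoc, smul_smul]
    simp
  | E_F_self i =>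
    simp only [map_sub, map_mul, FreeAlgebra.lift_ι_apply]
    rw [antipode_EF, ED_FD_self]
    simp only [antipodeGen, ← MulOpposite.op_sub]
    congr 1
    simp [mul_sub, sub_mul, mul_assoc]
  | E_F_of_ne i j hij =>
    simp only [map_sub, map_mul, FreeAlgebra.lift_ι_apply]
    rw [antipode_EF, ED_FD_of_ne hij]
    simp
  | nichols_E x hx =>
    rw [comp_lift, map_zero]
    simp only [FreeAlgebra.lift_ι_apply]
    exact NicholsDiag.antipode_map_eq_zero (q := 𝓔.q) (ED 𝓔) (fun i => gD 𝓔 (𝓔.g i))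
      (fun i => gD 𝓔 (𝓔.g i)⁻¹) gE_q
      (fun _ _ => gD_comm _ _) (fun _ => gD_mul_inv _) (fun _ => gD_inv_mul _) nichols_ED hx
  | nichols_F x hx =>
    rw [comp_lift, map_zero]
    simp only [FreeAlgebra.lift_ι_apply]
    exact NicholsDiag.antipode_cop_map_eq_zero (q := fun i j => 𝓔.q j i) (FD 𝓔)
      (fun i => hD 𝓔 (𝓔.h i)) (fun i => hD 𝓔 (𝓔.h i)⁻¹) hF_q
      (fun _ _ => hD_comm _ _) (fun _ => hD_mul_inv _) (fun _ => hD_inv_mul _) nichols_FD hx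

variable (𝓔) in
/-- The comultiplication of `D(𝓔)`. -/
def comulHom : D 𝓔 →ₐ[k] D 𝓔 ⊗[k] D 𝓔 := liftD (comulGen 𝓔) comulGen_rel

variable (𝓔) in
/-- The counit of `D(𝓔)`. -/
def counitHom : D 𝓔 →ₐ[k] k := liftD counitGen counitGen_rel

variable (𝓔) in
/-- The antipode of `D(𝓔)`, as an algebra map to the opposite algebra. -/
def antipodeHom : D 𝓔 →ₐ[k] (D 𝓔)ᵐᵒᵖ := liftD (antipodeGen 𝓔) antipodeGen_rel

@[simp] lemma comulHom_gD (a : Γ) : comulHom 𝓔 (gD 𝓔 a) = gD 𝓔 a ⊗ₜ gD 𝓔 a := by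
  simp [comulHom, gD, liftD_toD, comulGen]

@[simp] lemma comulHom_hD (a : Λ) : comulHom 𝓔 (hD 𝓔 a) = hD 𝓔 a ⊗ₜ hD 𝓔 a := by
  simp [comulHom, hD, liftD_toD, comulGen]

@[simp] lemma comulHom_ED (i : ι) :
    comulHom 𝓔 (ED 𝓔 i) = ED 𝓔 i ⊗ₜ 1 + gD 𝓔 (𝓔.g i) ⊗ₜ ED 𝓔 i := by
  simp [comulHom, ED, liftD_toD, comulGen]

@[simp] lemma comulHom_FD (i : ι) :
    comulHom 𝓔 (FD 𝓔 i) = FD 𝓔 i ⊗ₜ hD 𝓔 (𝓔.h i) + 1 ⊗ₜ FD 𝓔 i := by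
  simp [comulHom, FD, liftD_toD, comulGen]

@[simp] lemma counitHom_gD (a : Γ) : counitHom 𝓔 (gD 𝓔 a) = 1 := by
  simp [counitHom, gD, liftD_toD, counitGen]

@[simp] lemma counitHom_hD (a : Λ) : counitHom 𝓔 (hD 𝓔 a) = 1 := by
  simp [counitHom, hD, liftD_toD, counitGen]

@[simp] lemma counitHom_ED (i : ι) : counitHom 𝓔 (ED 𝓔 i) = 0 := by
  simp [counitHom, ED, liftD_toD, counitGen]

@[simp] lemma counitHom_FD (i : ι) : counitHom 𝓔 (FD 𝓔 i) = 0 := by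
  simp [counitHom, FD, liftD_toD, counitGen]

@[simp] lemma antipodeHom_gD (a : Γ) : antipodeHom 𝓔 (gD 𝓔 a) = .op (gD 𝓔 a⁻¹) := by
  simp [antipodeHom, gD, liftD_toD, antipodeGen]

@[simp] lemma antipodeHom_hD (a : Λ) : antipodeHom 𝓔 (hD 𝓔 a) = .op (hD 𝓔 a⁻¹) := by
  simp [antipodeHom, hD, liftD_toD, antipodeGen]

@[simp] lemma antipodeHom_ED (i : ι) :
    antipodeHom 𝓔 (ED 𝓔 i) = .op (-(gD 𝓔 (𝓔.g i)⁻¹ * ED 𝓔 i)) := by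
  simp [antipodeHom, ED, liftD_toD, antipodeGen]

@[simp] lemma antipodeHom_FD (i : ι) :
    antipodeHom 𝓔 (FD 𝓔 i) = .op (-(FD 𝓔 i * hD 𝓔 (𝓔.h i)⁻¹)) := by
  simp [antipodeHom, FD, liftD_toD, antipodeGen]

instance : Bialgebra k (D 𝓔) := .ofAlgHom (comulHom 𝓔) (counitHom 𝓔)
  (by
    apply algHom_ext <;> intro i <;>
      simp [Algebra.TensorProduct.one_def, TensorProduct.add_tmul, TensorProduct.tmul_add,
        add_assoc])
  (by
    apply algHom_ext <;> intro i <;> simp)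
  (by
    apply algHom_ext <;> intro i <;> simp)

lemma comul_eq (x : D 𝓔) : Coalgebra.comul (R := k) x = comulHom 𝓔 x := rfl

lemma counit_eq (x : D 𝓔) : Coalgebra.counit (R := k) x = counitHom 𝓔 x := rfl

variable (𝓔) in
/-- The antipode of `D(𝓔)`. -/
def antipodeD : D 𝓔 →ₗ[k] D 𝓔 :=
  (MulOpposite.opLinearEquiv k).symm.toLinearMap.comp (antipodeHom 𝓔).toLinearMap

lemma antipodeD_apply (x : D 𝓔) : antipodeD 𝓔 x = (antipodeHom 𝓔 x).unop := rfl

lemma antipodeD_mul (x y : D 𝓔) : antipodeD 𝓔 (x * y) = antipodeD 𝓔 y * antipodeD 𝓔 x := by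
  simp [antipodeD_apply]

lemma induction {p : D 𝓔 → Prop} (hg : ∀ a, p (gD 𝓔 a)) (hh : ∀ b, p (hD 𝓔 b))
    (hE : ∀ i, p (ED 𝓔 i)) (hF : ∀ i, p (FD 𝓔 i)) (hs : ∀ r : k, p (algebraMap k _ r))
    (hm : ∀ x y, p x → p y → p (x * y)) (ha : ∀ x y, p x → p y → p (x + y)) (x : D 𝓔) : p x := by
  obtain ⟨x, rfl⟩ := toD_surjective x
  induction x using FreeAlgebra.induction with
  | grade0 r => simpa using hs r
  | grade1 x =>
    cases x with
    | g a => exact hg a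
    | h b => exact hh b
    | E i => exact hE i
    | F i => exact hF i
  | mul a b iha ihb => rw [map_mul]; exact hm _ _ iha ihb
  | add a b iha ihb => rw [map_add]; exact ha _ _ iha ihb

lemma antipode_left_mul (w : D 𝓔 ⊗[k] D 𝓔) (a b : D 𝓔) :
    LinearMap.mul' k (D 𝓔) ((antipodeD 𝓔).rTensor (D 𝓔) (w * (a ⊗ₜ b))) =
      antipodeD 𝓔 a * LinearMap.mul' k (D 𝓔) ((antipodeD 𝓔).rTensor (D 𝓔) w) * b := by
  induction w using TensorProduct.induction_on with
  | zero => simp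
  | tmul x y => simp [antipodeD_mul, mul_assoc]
  | add x y hx hy => simp only [add_mul, map_add, hx, hy, mul_add]

lemma antipode_right_mul (w : D 𝓔 ⊗[k] D 𝓔) (a b : D 𝓔) :
    LinearMap.mul' k (D 𝓔) ((antipodeD 𝓔).lTensor (D 𝓔) ((a ⊗ₜ b) * w)) =
      a * LinearMap.mul' k (D 𝓔) ((antipodeD 𝓔).lTensor (D 𝓔) w) * antipodeD 𝓔 b := by
  induction w using TensorProduct.induction_on with
  | zero => simp
  | tmul x y => simp [antipodeD_mul, mul_assoc]
  | add x y hx hy => simp only [add_mul, map_add, hx, hy, mul_add]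

instance : HopfAlgebra k (D 𝓔) where
  antipode := antipodeD 𝓔
  mul_antipode_rTensor_comul := by
    ext x
    simp only [LinearMap.comp_apply, comul_eq, counit_eq, Algebra.linearMap_apply]
    induction x using induction with
    | hg a => simp [antipodeD_apply]
    | hh a => simp [antipodeD_apply]
    | hE i => simp [antipodeD_apply]
    | hF i => simp [antipodeD_apply, mul_assoc]
    | hs r => simp [antipodeD_apply, Algebra.TensorProduct.algebraMap_apply]
    | hm x y hx hy =>
      have : ∀ w : D 𝓔 ⊗[k] D 𝓔,
          LinearMap.mul' k (D 𝓔) ((antipodeD 𝓔).rTensor (D 𝓔) (comulHom 𝓔 x * w)) =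
          algebraMap k (D 𝓔) (counitHom 𝓔 x) *
            LinearMap.mul' k (D 𝓔) ((antipodeD 𝓔).rTensor (D 𝓔) w) := by
        intro w
        induction w using TensorProduct.induction_on with
        | zero => simp
        | tmul a b =>
          rw [antipode_left_mul, hx, ← Algebra.commutes]
          simp [mul_assoc]
        | add a b ha hb => simp only [mul_add, map_add, ha, hb]
      rw [map_mul, this, hy, map_mul, map_mul]
    | ha x y hx hy => simp only [map_add, hx, hy]
  mul_antipode_lTensor_comul := by
    ext x
    simp only [LinearMap.comp_apply, comul_eq, counit_eq, Algebra.linearMap_apply]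
    induction x using induction with
    | hg a => simp [antipodeD_apply]
    | hh a => simp [antipodeD_apply]
    | hE i => simp [antipodeD_apply, ← mul_assoc]
    | hF i => simp [antipodeD_apply]
    | hs r => simp [antipodeD_apply, Algebra.TensorProduct.algebraMap_apply]
    | hm x y hx hy =>
      have : ∀ w : D 𝓔 ⊗[k] D 𝓔,
          LinearMap.mul' k (D 𝓔) ((antipodeD 𝓔).lTensor (D 𝓔) (w * comulHom 𝓔 y)) =
          LinearMap.mul' k (D 𝓔) ((antipodeD 𝓔).lTensor (D 𝓔) w) *
            algebraMap k (D 𝓔) (counitHom 𝓔 y) := by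
        intro w
        induction w using TensorProduct.induction_on with
        | zero => simp
        | tmul a b =>
          rw [antipode_right_mul, hy, mul_assoc, Algebra.commutes]
          simp [mul_assoc]
        | add a b ha hb => simp only [add_mul, map_add, ha, hb]
      rw [map_mul, this, hx, map_mul, map_mul]
    | ha x y hx hy => simp only [map_add, hx, hy]

end DoubleDatum

/-! ## Coloured quantum doubles -/

namespace ColorDouble

/-- The free abelian group on `ι`, written multiplicatively. -/
abbrev FreeAb (ι : Type*) := Multiplicative (FreeAbelianGroup ι)

/-- The basis elements of the free abelian group. -/
def basisElt {ι : Type*} (i : ι) : FreeAb ι := Multiplicative.ofAdd (FreeAbelianGroup.of i)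

/-- The homomorphism from the free abelian group with prescribed values on the basis. -/
def freeLift {ι M : Type*} [CommGroup M] (f : ι → M) : FreeAb ι →* M :=
  AddMonoidHom.toMultiplicativeLeft (FreeAbelianGroup.lift fun i => Additive.ofMul (f i))

@[simp] lemma freeLift_basisElt {ι M : Type*} [CommGroup M] (f : ι → M) (i : ι) :
    freeLift f (basisElt i) = f i := by
  simp [freeLift, basisElt]

variable {k G : Type*} [Field k] [CommGroup G]

/-- The homomorphism `χ : G → Ĝ`, `χ_g(h) = β(h, g)`. -/
def chi (β : G →* G →* kˣ) : G →* (G →* kˣ) := β.flip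

/-- The homomorphism `χᵒ : G → Ĝ`, `χᵒ_h(g) = β(h, g)`. -/
def chiO (β : G →* G →* kˣ) : G →* (G →* kˣ) := β

/-- A bicharacter is non-degenerate if both its kernels are trivial. -/
def Nondegenerate (β : G →* G →* kˣ) : Prop :=
  (∀ g, (∀ h, β g h = 1) → g = 1) ∧ (∀ h, (∀ g, β g h = 1) → h = 1)

/-- For a non-degenerate bicharacter, `χᵒ` is an isomorphism of groups. -/
def chiOEquiv [IsAlgClosed k] [CharZero k] [Finite G] (β : G →* G →* kˣ)
    (hβ : Nondegenerate β) : G ≃* (G →* kˣ) :=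
  MulEquiv.ofBijective (chiO β) <| by
    have hinj : Function.Injective (chiO β) := by
      refine (injective_iff_map_eq_one _).2 fun g hg => hβ.1 g fun h => ?_
      exact DFunLike.congr_fun hg h
    obtain ⟨e⟩ := CommGroup.monoidHom_mulEquiv_of_hasEnoughRootsOfUnity G k
    have : Finite (G →* kˣ) := Finite.of_equiv G e.symm.toEquiv
    exact hinj.bijective_of_nat_card_le (Nat.card_congr e.toEquiv).le

variable {ι : Type*}

/-- The matrix `q̃_{ij} = β(t_i, t_j)⁻¹ q_{ij}`. -/
def qTilde (β : G →* G →* kˣ) (q : ι → ι → kˣ) (t : ι → G) (i j : ι) : kˣ :=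
  (β (t i) (t j))⁻¹ * q i j

/-- The datum `𝓔` attached to a bicharacter `β` on `G`, a matrix `q` and a family `t` in `G`.
Here `Γ = Γ₀ × G` with `Γ₀` free abelian on `K_i` and `Λ = Λ₀ × Ĝ` with `Λ₀` free abelian on
`L_i`; moreover, with `ξ_i = χ_{t_i}`,
* `g_i = (K_i, t_i)` and `h_i = (L_i, ξ_i)`;
* `γ_j(K_i) = q̃_{ij}` and `γ_j(s) = ξ_j(s)` for `s ∈ G`;
* `λ_j(L_i) = q̃_{ji}` and `λ_j(α) = α(t_j)` for `α ∈ Ĝ`;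
* `μ(K_i, L_j) = q̃_{ij}`, `μ(s, α) = α(s)`, `μ(K_i, α) = 1` and `μ(s, L_j) = 1`. -/
def datum (β : G →* G →* kˣ) (q : ι → ι → kˣ) (t : ι → G) :
    DoubleDatum k ι (FreeAb ι × G) (FreeAb ι × (G →* kˣ)) where
  q := q
  g i := (basisElt i, t i)
  γ j := (freeLift fun i => qTilde β q t i j).coprod (chi β (t j))
  h i := (basisElt i, chi β (t i))
  lam j := (freeLift fun i => qTilde β q t j i).coprod (MonoidHom.eval (t j))
  μ := MonoidHom.coprod
    (freeLift fun i => (freeLift fun j => qTilde β q t i j).comp (MonoidHom.fst _ _))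
    (MonoidHom.mk' (fun s => (MonoidHom.eval s).comp (MonoidHom.snd _ _))
      (fun a b => by ext x; simp))
  γ_g i j := by simp [qTilde, chi]
  lam_h i j := by simp [qTilde, chi]
  μ_g_h i j := by simp [qTilde, chi]

/-- The quantum double `D(𝓔)`. -/
abbrev D (β : G →* G →* kˣ) (q : ι → ι → kˣ) (t : ι → G) := (datum β q t).D

variable (β : G →* G →* kˣ) (q : ι → ι → kˣ) (t : ι → G)

/-- The element `s χᵒ_s` of `D(𝓔)`, for `s ∈ G`. -/
def centralElt (s : G) : D β q t :=
  (datum β q t).gD (1, s) * (datum β q t).hD (1, chiO β s)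

/-- The ideal `I(𝓔)` of `D(𝓔)` generated by the elements `s χᵒ_s - 1`, `s ∈ G`. -/
def idealI : TwoSidedIdeal (D β q t) :=
  TwoSidedIdeal.span (Set.range fun s => centralElt β q t s - 1)

lemma comul_centralElt (s : G) :
    Bialgebra.comulAlgHom k (D β q t) (centralElt β q t s) =
      centralElt β q t s ⊗ₜ centralElt β q t s := by
  rw [Bialgebra.comulAlgHom_apply, DoubleDatum.comul_eq]
  simp [centralElt]

lemma counit_centralElt (s : G) :
    Bialgebra.counitAlgHom k (D β q t) (centralElt β q t s) = 1 := by
  rw [Bialgebra.counitAlgHom_apply, DoubleDatum.counit_eq]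
  simp [centralElt]

lemma antipode_centralElt (s : G) :
    DoubleDatum.antipodeHom (datum β q t) (centralElt β q t s) =
      .op (centralElt β q t s⁻¹) := by
  simp [centralElt, ← MulOpposite.op_mul, DoubleDatum.gD_hD]

instance : ((idealI β q t).asIdeal).IsHopfIdeal k where
  counit_eq_zero := by
    intro x hx
    have : idealI β q t ≤ TwoSidedIdeal.ker (Bialgebra.counitAlgHom k (D β q t)) := by
      refine TwoSidedIdeal.span_le.2 ?_
      rintro _ ⟨s, rfl⟩
      refine (TwoSidedIdeal.mem_ker _).2 ?_
      rw [map_sub, counit_centralElt, map_one, sub_self]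
    exact (TwoSidedIdeal.mem_ker (Bialgebra.counitAlgHom k (D β q t))).1 (this hx)
  map_mkQ_comul_eq_zero := by
    intro x hx
    let p : D β q t →ₐ[k] D β q t ⧸ (idealI β q t).asIdeal := Ideal.Quotient.mkₐ k _
    have hp : ∀ s, p (centralElt β q t s) = 1 := by
      intro s
      rw [← sub_eq_zero, ← map_one p, ← map_sub]
      exact Ideal.Quotient.eq_zero_iff_mem.2 (TwoSidedIdeal.subset_span ⟨s, rfl⟩)
    have : idealI β q t ≤ TwoSidedIdeal.ker
        ((Algebra.TensorProduct.map p p).comp (Bialgebra.comulAlgHom k (D β q t))) := by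
      refine TwoSidedIdeal.span_le.2 ?_
      rintro _ ⟨s, rfl⟩
      refine (TwoSidedIdeal.mem_ker _).2 ?_
      rw [map_sub, AlgHom.comp_apply, comul_centralElt, map_one,
        Algebra.TensorProduct.map_tmul, hp, Algebra.TensorProduct.one_def, sub_self]
    exact (TwoSidedIdeal.mem_ker _).1 (this hx)
  antipode_mem := by
    intro x hx
    let p : D β q t →ₐ[k] D β q t ⧸ (idealI β q t).asIdeal := Ideal.Quotient.mkₐ k _
    have hp : ∀ s, p (centralElt β q t s) = 1 := by
      intro s
      rw [← sub_eq_zero, ← map_one p, ← map_sub]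
      exact Ideal.Quotient.eq_zero_iff_mem.2 (TwoSidedIdeal.subset_span ⟨s, rfl⟩)
    have : idealI β q t ≤ TwoSidedIdeal.ker
        ((AlgHom.op p).comp (DoubleDatum.antipodeHom (datum β q t))) := by
      refine TwoSidedIdeal.span_le.2 ?_
      rintro _ ⟨s, rfl⟩
      refine (TwoSidedIdeal.mem_ker _).2 ?_
      rw [map_sub, AlgHom.comp_apply, antipode_centralElt, map_one]
      simp [hp]
    have h := (TwoSidedIdeal.mem_ker _).1 (this hx)
    exact Ideal.Quotient.eq_zero_iff_mem.1 (congrArg MulOpposite.unop h)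

/-- The Hopf algebra `U(𝓔) = D(𝓔) / I(𝓔)`. -/
abbrev U := D β q t ⧸ (idealI β q t).asIdeal

/-- The projection `D(𝓔) → U(𝓔)`. -/
def proj : D β q t →ₐc[k] U β q t := Bialgebra.Quotient.mkBialgHom (idealI β q t).asIdeal

/-- The image in `U(𝓔)` of an element of `G`. -/
def elt (s : G) : U β q t := proj β q t ((datum β q t).gD (1, s))

/-- The generator `K_i` of `U(𝓔)`. -/
def K (i : ι) : U β q t := proj β q t ((datum β q t).gD (basisElt i, 1))

/-- The generator `L_i` of `U(𝓔)`. -/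
def L (i : ι) : U β q t := proj β q t ((datum β q t).hD (basisElt i, 1))

/-- The generator `E_i` of `U(𝓔)`. -/
def E (i : ι) : U β q t := proj β q t ((datum β q t).ED i)

/-- The generator `F_i` of `U(𝓔)`. -/
def F (i : ι) : U β q t := proj β q t ((datum β q t).FD i)

lemma isGroupLikeElem_elt (s : G) : IsGroupLikeElem k (elt β q t s) := by
  have h : IsGroupLikeElem k ((datum β q t).gD (1, s)) := by
    constructor
    · rw [DoubleDatum.counit_eq]; simp
    · rw [DoubleDatum.comul_eq]; simp
  exact h.map (proj β q t)

/-- The canonical Hopf algebra map `kG → U(𝓔)`. -/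
def incl : MonoidAlgebra k G →ₐc[k] U β q t :=
  .ofAlgHom
    (MonoidAlgebra.lift k (U β q t) G
      { toFun := elt β q t
        map_one' := by
          show proj β q t ((datum β q t).gD 1) = 1
          rw [DoubleDatum.gD_one, map_one]
        map_mul' := fun a b => by
          simp only [elt]
          rw [← map_mul, ← DoubleDatum.gD_mul, Prod.mk_mul_mk, one_mul] })
    (by ext s; simp [(isGroupLikeElem_elt β q t s).counit_eq_one])
    (by ext s; simp [(isGroupLikeElem_elt β q t s).comul_eq_tmul_self])

end ColorDouble

end

/-!
The algebra `kG` is commutative and its group-like elements are the elements of `G`. These two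
facts govern the retractions `π : U(𝓔) → kG`.

Put `g_i = K_i t_i` and `h_i = L_i ξ_i`. As `g_i E_i = q_{ii} E_i g_i` and `π(g_i)` is invertible,
commutativity gives `(1 - q_{ii}) π(E_i) = 0`, so `π(E_i) = 0` because `q_{ii} ≠ 1`; in the same way
`π(F_i) = 0` (`eq_zero_of_mul_eq_smul_mul`). Then `E_i F_i - F_i E_i = g_i - h_i` forces
`π(g_i) = π(h_i)`. Since `s χᵒ_s = 1` in `U(𝓔)`, a character `α` must go to the inverse of
`(χᵒ)⁻¹(α)`, and hence `π(L_i) = t_i π(K_i) (χᵒ)⁻¹(ξ_i)`. So `π` is determined by the elements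
`π(K_i)`, which are group-like and therefore lie in `G` (`algHom_ext_of_commRing`,
`exists_hom_of_retraction`).

Conversely, for every homomorphism `ϖ : Γ₀ → G` the prescribed values on the generators satisfy the
defining relations of `D(𝓔)`: those involving `E` or `F` hold because both sides vanish and
`g_i`, `h_i` have the same image, the Nichols relations because they have no constant term. The
resulting map kills `s χᵒ_s - 1` and descends to a retraction (`retraction`). Already the existence
of one retraction shows that `kG → U(𝓔)` is injective.
-/

noncomputable section

namespace ColorDouble

/-! ### Generators of the quotient -/

section Generators

variable {k G ι : Type*} [Field k] [CommGroup G]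
  (β : G →* G →* kˣ) (q : ι → ι → kˣ) (t : ι → G)

/-- Homomorphisms from the free abelian group to a monoid, not necessarily commutative, agree if
they agree on the basis. -/
lemma freeAb_hom_ext {M : Type*} [Monoid M] {f g : FreeAb ι →* M}
    (h : ∀ i, f (basisElt i) = g (basisElt i)) : f = g := by
  ext a
  change a ∈ f.eqLocus g
  induction a using Multiplicative.rec with | _ a =>
  induction a using FreeAbelianGroup.induction_on with
  | zero => exact one_mem (f.eqLocus g)
  | of i => exact h i
  | neg i _ => exact (f.eqLocus g).inv_mem (h i)
  | add a b ha hb => exact (f.eqLocus g).mul_mem ha hb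

lemma monoidHom_prod_ext {M N P : Type*} [MulOneClass M] [MulOneClass N] [MulOneClass P]
    {f g : M × N →* P} (hl : ∀ a, f (a, 1) = g (a, 1)) (hr : ∀ b, f (1, b) = g (1, b)) :
    f = g := by
  ext ⟨a, b⟩
  rw [← Prod.fst_mul_snd (a, b), map_mul, map_mul, hl, hr]

/-- The homomorphism `Γ → U(𝓔)`. -/
def gHom : FreeAb ι × G →* U β q t where
  toFun a := proj β q t ((datum β q t).gD a)
  map_one' := by rw [DoubleDatum.gD_one, map_one]
  map_mul' a b := by rw [DoubleDatum.gD_mul, map_mul]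

/-- The homomorphism `Λ → U(𝓔)`. -/
def hHom : FreeAb ι × (G →* kˣ) →* U β q t where
  toFun b := proj β q t ((datum β q t).hD b)
  map_one' := by rw [DoubleDatum.hD_one, map_one]
  map_mul' a b := by rw [DoubleDatum.hD_mul, map_mul]

lemma gHom_basisElt (i : ι) : gHom β q t (basisElt i, 1) = K β q t i := rfl

lemma gHom_elt (s : G) : gHom β q t (1, s) = elt β q t s := rfl

lemma hHom_basisElt (i : ι) : hHom β q t (basisElt i, 1) = L β q t i := rfl

lemma gHom_g (i : ι) : gHom β q t ((datum β q t).g i) = K β q t i * elt β q t (t i) := by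
  rw [← gHom_basisElt, ← gHom_elt, ← map_mul, Prod.mk_mul_mk, one_mul, mul_one]; rfl

lemma hHom_h (i : ι) :
    hHom β q t ((datum β q t).h i) = L β q t i * hHom β q t (1, chi β (t i)) := by
  rw [← hHom_basisElt, ← map_mul, Prod.mk_mul_mk, mul_one, one_mul (chi β (t i))]; rfl

lemma elt_mul_hHom_chiO (s : G) : elt β q t s * hHom β q t (1, chiO β s) = 1 := by
  change proj β q t _ * proj β q t _ = 1
  rw [← map_mul, ← sub_eq_zero, ← map_one (proj β q t), ← map_sub]
  exact Ideal.Quotient.eq_zero_iff_mem.2 (TwoSidedIdeal.subset_span ⟨s, rfl⟩)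

lemma gHom_mul_E (i : ι) : gHom β q t ((datum β q t).g i) * E β q t i =
    (q i i : k) • (E β q t i * gHom β q t ((datum β q t).g i)) := by
  change proj β q t _ * proj β q t _ = _ • (proj β q t _ * proj β q t _)
  rw [← map_mul, ← map_mul, ← map_smul]
  exact congrArg _ (DoubleDatum.gE_q i i)

lemma hHom_mul_F (i : ι) : hHom β q t ((datum β q t).h i) * F β q t i =
    (q i i : k) • (F β q t i * hHom β q t ((datum β q t).h i)) := by
  change proj β q t _ * proj β q t _ = _ • (proj β q t _ * proj β q t _)
  rw [← map_mul, ← map_mul, ← map_smul]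
  exact congrArg _ (DoubleDatum.hF_q i i)

lemma E_mul_F_sub (i : ι) : E β q t i * F β q t i - F β q t i * E β q t i =
    gHom β q t ((datum β q t).g i) - hHom β q t ((datum β q t).h i) := by
  change proj β q t _ * proj β q t _ - proj β q t _ * proj β q t _ = proj β q t _ - proj β q t _
  rw [← map_mul, ← map_mul, ← map_sub, ← map_sub, DoubleDatum.ED_FD_self]

lemma isGroupLikeElem_K (i : ι) : IsGroupLikeElem k (K β q t i) := by
  have h : IsGroupLikeElem k ((datum β q t).gD (basisElt i, 1)) := by
    constructor
    · rw [DoubleDatum.counit_eq]; simp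
    · rw [DoubleDatum.comul_eq]; simp
  exact h.map (proj β q t)

lemma incl_of (s : G) : incl β q t (MonoidAlgebra.of k G s) = elt β q t s := by
  change MonoidAlgebra.lift k (U β q t) G _ (MonoidAlgebra.of k G s) = _
  rw [MonoidAlgebra.lift_of]; rfl

variable {β q t}

lemma algHom_ext {B : Type*} [Semiring B] [Algebra k B] {φ ψ : U β q t →ₐ[k] B}
    (hg : ∀ a, φ (gHom β q t a) = ψ (gHom β q t a)) (hh : ∀ b, φ (hHom β q t b) = ψ (hHom β q t b))
    (hE : ∀ i, φ (E β q t i) = ψ (E β q t i)) (hF : ∀ i, φ (F β q t i) = ψ (F β q t i)) :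
    φ = ψ :=
  Ideal.Quotient.algHom_ext k (DoubleDatum.algHom_ext (φ := φ.comp (Ideal.Quotient.mkₐ k _))
    (ψ := ψ.comp (Ideal.Quotient.mkₐ k _)) hg hh hE hF)

/-! ### Uniqueness of retractions -/

/-- In a commutative algebra, an element that `c`-commutes with a unit, `c ≠ 1`, vanishes. -/
lemma eq_zero_of_mul_eq_smul_mul {B : Type*} [CommRing B] [Algebra k B] {c : k} (hc : c ≠ 1)
    {u x : B} (hu : IsUnit u) (h : u * x = c • (x * u)) : x = 0 := by
  rw [mul_comm x u, ← mul_smul_comm] at h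
  have h1 : (1 - c) • x = 0 := by rw [sub_smul, one_smul, ← hu.mul_left_cancel h, sub_self]
  rwa [smul_eq_zero_iff_right (sub_ne_zero.2 hc.symm)] at h1

lemma map_E_eq_zero {B : Type*} [CommRing B] [Algebra k B] (φ : U β q t →ₐ[k] B)
    {i : ι} (hq : q i i ≠ 1) : φ (E β q t i) = 0 := by
  refine eq_zero_of_mul_eq_smul_mul (c := (q i i : k)) (by simpa using hq)
    (((Group.isUnit ((datum β q t).g i)).map (gHom β q t)).map φ) ?_
  rw [← map_mul, gHom_mul_E, map_smul, map_mul]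

lemma map_F_eq_zero {B : Type*} [CommRing B] [Algebra k B] (φ : U β q t →ₐ[k] B)
    {i : ι} (hq : q i i ≠ 1) : φ (F β q t i) = 0 := by
  refine eq_zero_of_mul_eq_smul_mul (c := (q i i : k)) (by simpa using hq)
    (((Group.isUnit ((datum β q t).h i)).map (hHom β q t)).map φ) ?_
  rw [← map_mul, hHom_mul_F, map_smul, map_mul]

lemma map_gHom_g_eq_map_hHom_h {B : Type*} [CommRing B] [Algebra k B] (φ : U β q t →ₐ[k] B)
    (i : ι) : φ (gHom β q t ((datum β q t).g i)) = φ (hHom β q t ((datum β q t).h i)) := by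
  rw [← sub_eq_zero, ← map_sub, ← E_mul_F_sub, map_sub, map_mul, map_mul, mul_comm, sub_self]

/-- An algebra map from `U(𝓔)` to a commutative algebra is determined by its values on `G` and on
the `K_i`. -/
lemma algHom_ext_of_commRing (hχ : Function.Surjective (chiO β)) (hq : ∀ i, q i i ≠ 1)
    {B : Type*} [CommRing B] [Algebra k B] {φ ψ : U β q t →ₐ[k] B}
    (hs : ∀ s, φ (elt β q t s) = ψ (elt β q t s)) (hK : ∀ i, φ (K β q t i) = ψ (K β q t i)) :
    φ = ψ := by
  have hα : ∀ α, φ (hHom β q t (1, α)) = ψ (hHom β q t (1, α)) := by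
    intro α
    obtain ⟨s, rfl⟩ := hχ α
    have h (f : U β q t →ₐ[k] B) : f (elt β q t s) * f (hHom β q t (1, chiO β s)) = 1 := by
      rw [← map_mul, elt_mul_hHom_chiO, map_one]
    exact left_inv_eq_right_inv ((mul_comm _ _).trans (h φ)) ((hs s).symm ▸ h ψ)
  have hL : ∀ i, φ (L β q t i) = ψ (L β q t i) := by
    intro i
    have h (f : U β q t →ₐ[k] B) : f (K β q t i) * f (elt β q t (t i)) =
        f (L β q t i) * f (hHom β q t (1, chi β (t i))) := by
      rw [← map_mul, ← map_mul, ← gHom_g, ← hHom_h, map_gHom_g_eq_map_hHom_h]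
    have hu : IsUnit (ψ (hHom β q t (1, chi β (t i)))) :=
      ((Group.isUnit ((1, chi β (t i)) : FreeAb ι × (G →* kˣ))).map (hHom β q t)).map ψ
    refine hu.mul_right_cancel ?_
    rw [← h ψ, ← hα, ← h φ, hK, hs]
  have hg : (φ : U β q t →* B).comp (gHom β q t) = (ψ : U β q t →* B).comp (gHom β q t) :=
    monoidHom_prod_ext (DFunLike.congr_fun (freeAb_hom_ext
      (f := ((φ : U β q t →* B).comp (gHom β q t)).comp (MonoidHom.inl _ _))
      (g := ((ψ : U β q t →* B).comp (gHom β q t)).comp (MonoidHom.inl _ _)) hK)) hs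
  have hh : (φ : U β q t →* B).comp (hHom β q t) = (ψ : U β q t →* B).comp (hHom β q t) :=
    monoidHom_prod_ext (DFunLike.congr_fun (freeAb_hom_ext
      (f := ((φ : U β q t →* B).comp (hHom β q t)).comp (MonoidHom.inl _ _))
      (g := ((ψ : U β q t →* B).comp (hHom β q t)).comp (MonoidHom.inl _ _)) hL)) hα
  refine algHom_ext (DFunLike.congr_fun hg) (DFunLike.congr_fun hh) (fun i => ?_) (fun i => ?_)
  · rw [map_E_eq_zero φ (hq i), map_E_eq_zero ψ (hq i)]
  · rw [map_F_eq_zero φ (hq i), map_F_eq_zero ψ (hq i)]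

lemma map_elt_of_retraction {π : U β q t →ₐc[k] MonoidAlgebra k G}
    (hπ : π.comp (incl β q t) = BialgHom.id k (MonoidAlgebra k G)) (s : G) :
    π (elt β q t s) = MonoidAlgebra.of k G s := by
  rw [← incl_of]
  exact DFunLike.congr_fun hπ _

/-- The images of the `K_i` under a bialgebra map to `kG` are group-like, hence elements of `G`. -/
lemma exists_hom_of_retraction (π : U β q t →ₐc[k] MonoidAlgebra k G) :
    ∃ ϖ : FreeAb ι →* G, ∀ i, π (K β q t i) = MonoidAlgebra.of k G (ϖ (basisElt i)) := by
  have h (i : ι) : ∃ a, MonoidAlgebra.of k G a = π (K β q t i) :=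
    MonoidAlgebra.isGroupLikeElem_iff_mem_range_of.1 ((isGroupLikeElem_K β q t i).map π)
  choose a ha using h
  exact ⟨freeLift a, fun i => by rw [freeLift_basisElt, ha]⟩

end Generators

/-! ### Existence of retractions -/

section Retraction

variable {k G ι : Type*} [Field k] [CommGroup G]
  (β : G →* G →* kˣ) (q : ι → ι → kˣ) (t : ι → G)
  (e : G ≃* (G →* kˣ)) (ϖ : FreeAb ι →* G)

/-- The homomorphism `Γ → G` which is `ϖ` on `Γ₀` and the identity on `G`. -/
def toGroupG : FreeAb ι × G →* G := ϖ.coprod (MonoidHom.id G)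

/-- The homomorphism `Λ → G` with `L_i ↦ t_i ϖ(K_i) e⁻¹(ξ_i)` and `α ↦ e⁻¹(α)⁻¹` for a character
`α`, where `e` plays the role of `χᵒ`. -/
def toGroupH : FreeAb ι × (G →* kˣ) →* G :=
  (freeLift fun i => t i * ϖ (basisElt i) * e.symm (chi β (t i))).coprod
    (e.symm : (G →* kˣ) →* G)⁻¹

/-- The images in `kG` of the generators of `D(𝓔)` under the retraction attached to `ϖ`. -/
def retractionGen : DoubleDatum.Gen ι (FreeAb ι × G) (FreeAb ι × (G →* kˣ)) → MonoidAlgebra k G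
  | .g a => MonoidAlgebra.of k G (toGroupG ϖ a)
  | .h b => MonoidAlgebra.of k G (toGroupH β t e ϖ b)
  | .E _ => 0
  | .F _ => 0

lemma toGroupG_g_eq_toGroupH_h (i : ι) :
    toGroupG ϖ ((datum β q t).g i) = toGroupH β t e ϖ ((datum β q t).h i) := by
  simp [toGroupG, toGroupH, datum, mul_comm]

lemma retractionGen_rel ⦃x y : DoubleDatum.Free k ι (FreeAb ι × G) (FreeAb ι × (G →* kˣ))⦄
    (h : DoubleDatum.Rel (datum β q t) x y) :
    FreeAlgebra.lift k (retractionGen β t e ϖ) x =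
      FreeAlgebra.lift k (retractionGen β t e ϖ) y := by
  -- A Nichols relation, evaluated at zero, is its constant term.
  have nichols {p : ι → ι → kˣ} {x : FreeAlgebra k ι} (hx : x ∈ NicholsDiag.nicholsIdeal p) :
      FreeAlgebra.lift k (fun _ : ι => (0 : MonoidAlgebra k G)) x = 0 := by
    have := congrArg (Algebra.ofId k (MonoidAlgebra k G)) (DoubleDatum.lift_zero_nichols hx)
    rw [DoubleDatum.comp_lift] at this
    simpa using this
  cases h with
  | nichols_E x hx =>
    rw [DoubleDatum.comp_lift, map_zero]
    simpa [retractionGen] using nichols hx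
  | nichols_F x hx =>
    rw [DoubleDatum.comp_lift, map_zero]
    simpa [retractionGen] using nichols hx
  | g_h a b =>
    simp only [map_mul, FreeAlgebra.lift_ι_apply]
    exact mul_comm _ _
  | E_F_self i =>
    simp only [map_sub, map_mul, FreeAlgebra.lift_ι_apply, retractionGen,
      toGroupG_g_eq_toGroupH_h β q t e]
    simp
  | g_mul a b => simp only [map_mul, FreeAlgebra.lift_ι_apply, retractionGen]
  | h_mul a b => simp only [map_mul, FreeAlgebra.lift_ι_apply, retractionGen]
  | g_one => simp only [map_one, FreeAlgebra.lift_ι_apply, retractionGen]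
  | h_one => simp only [map_one, FreeAlgebra.lift_ι_apply, retractionGen]
  | _ => simp [retractionGen]

/-- The algebra map `D(𝓔) → kG` attached to `ϖ`. -/
def retractionD : D β q t →ₐ[k] MonoidAlgebra k G :=
  DoubleDatum.liftD (retractionGen β t e ϖ) (retractionGen_rel β q t e ϖ)

lemma retractionD_gD (a : FreeAb ι × G) : retractionD β q t e ϖ ((datum β q t).gD a) =
    MonoidAlgebra.of k G (toGroupG ϖ a) := by
  rw [retractionD, DoubleDatum.gD, DoubleDatum.liftD_toD, FreeAlgebra.lift_ι_apply]; rfl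

lemma retractionD_hD (b : FreeAb ι × (G →* kˣ)) : retractionD β q t e ϖ ((datum β q t).hD b) =
    MonoidAlgebra.of k G (toGroupH β t e ϖ b) := by
  rw [retractionD, DoubleDatum.hD, DoubleDatum.liftD_toD, FreeAlgebra.lift_ι_apply]; rfl

lemma retractionD_ED (i : ι) : retractionD β q t e ϖ ((datum β q t).ED i) = 0 := by
  rw [retractionD, DoubleDatum.ED, DoubleDatum.liftD_toD, FreeAlgebra.lift_ι_apply]; rfl

lemma retractionD_FD (i : ι) : retractionD β q t e ϖ ((datum β q t).FD i) = 0 := by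
  rw [retractionD, DoubleDatum.FD, DoubleDatum.liftD_toD, FreeAlgebra.lift_ι_apply]; rfl

lemma counit_comp_retractionD :
    (Bialgebra.counitAlgHom k (MonoidAlgebra k G)).comp (retractionD β q t e ϖ) =
      DoubleDatum.counitHom (datum β q t) := by
  apply DoubleDatum.algHom_ext <;> intro <;>
    simp [retractionD_gD, retractionD_hD, retractionD_ED, retractionD_FD]

lemma map_retractionD_comp_comul :
    (Algebra.TensorProduct.map (retractionD β q t e ϖ) (retractionD β q t e ϖ)).comp
        (DoubleDatum.comulHom (datum β q t)) =
      (Bialgebra.comulAlgHom k (MonoidAlgebra k G)).comp (retractionD β q t e ϖ) := by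
  apply DoubleDatum.algHom_ext <;> intro <;>
    simp [retractionD_gD, retractionD_hD, retractionD_ED, retractionD_FD]

variable {e}

lemma retractionD_centralElt (he : ∀ s, e s = chiO β s) (s : G) :
    retractionD β q t e ϖ (centralElt β q t s) = 1 := by
  rw [centralElt, map_mul, retractionD_gD, retractionD_hD, ← map_mul]
  simp [toGroupG, toGroupH, ← he, MonoidAlgebra.one_def]

lemma retractionD_eq_zero (he : ∀ s, e s = chiO β s) (x : D β q t)
    (hx : x ∈ (idealI β q t).asIdeal) : retractionD β q t e ϖ x = 0 := by
  have : idealI β q t ≤ TwoSidedIdeal.ker (retractionD β q t e ϖ) := by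
    refine TwoSidedIdeal.span_le.2 ?_
    rintro _ ⟨s, rfl⟩
    refine (TwoSidedIdeal.mem_ker _).2 ?_
    rw [map_sub, retractionD_centralElt β q t ϖ he, map_one, sub_self]
  exact (TwoSidedIdeal.mem_ker _).1 (this hx)

/-- The retraction `U(𝓔) → kG` attached to `ϖ`, as an algebra map. -/
def retractionAlgHom (he : ∀ s, e s = chiO β s) : U β q t →ₐ[k] MonoidAlgebra k G :=
  Ideal.Quotient.liftₐ _ (retractionD β q t e ϖ) (retractionD_eq_zero β q t ϖ he)

variable (he : ∀ s, e s = chiO β s)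

/-- The retraction `U(𝓔) → kG` attached to `ϖ`, as a bialgebra map. -/
def retraction : U β q t →ₐc[k] MonoidAlgebra k G :=
  .ofAlgHom (retractionAlgHom β q t ϖ he)
    (Ideal.Quotient.algHom_ext k (counit_comp_retractionD β q t e ϖ))
    (Ideal.Quotient.algHom_ext k (AlgHom.ext fun x => by
      refine Eq.trans ?_ (DFunLike.congr_fun (map_retractionD_comp_comul β q t e ϖ) x)
      -- `Δ(proj x)` is by definition the image of `Δ(x)` under `proj ⊗ proj`.
      change Algebra.TensorProduct.map (retractionAlgHom β q t ϖ he) (retractionAlgHom β q t ϖ he)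
        (Algebra.TensorProduct.map (Ideal.Quotient.mkₐ k _) (Ideal.Quotient.mkₐ k _)
          (DoubleDatum.comulHom (datum β q t) x)) = _
      rw [← AlgHom.comp_apply, ← Algebra.TensorProduct.map_comp]
      rfl))

lemma retraction_proj (x : D β q t) :
    retraction β q t ϖ he (proj β q t x) = retractionD β q t e ϖ x := rfl

lemma retraction_elt (s : G) : retraction β q t ϖ he (elt β q t s) = MonoidAlgebra.of k G s := by
  rw [elt, retraction_proj, retractionD_gD]; simp [toGroupG]

lemma retraction_K (i : ι) : retraction β q t ϖ he (K β q t i) =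
    MonoidAlgebra.of k G (ϖ (basisElt i)) := by
  rw [K, retraction_proj, retractionD_gD]; simp [toGroupG]

lemma retraction_L (i : ι) : retraction β q t ϖ he (L β q t i) =
    MonoidAlgebra.of k G (t i * ϖ (basisElt i) * e.symm (chi β (t i))) := by
  rw [L, retraction_proj, retractionD_hD]; simp [toGroupH]

lemma retraction_comp_incl :
    (retraction β q t ϖ he).comp (incl β q t) = BialgHom.id k (MonoidAlgebra k G) := by
  refine BialgHom.coe_toAlgHom_injective 
    (MonoidAlgebra.algHom_ext' (MonoidHom.ext fun s => ?_) (by ext))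
  change retraction β q t ϖ he (incl β q t (MonoidAlgebra.of k G s)) = MonoidAlgebra.of k G s
  rw [incl_of, retraction_elt]

end Retraction

end ColorDouble

end

theorem mainTheorem2 {k G : Type*} [Field k] [IsAlgClosed k] [CharZero k]
    [CommGroup G] [Finite G] (β : G →* G →* kˣ) (hβ : ColorDouble.Nondegenerate β)
    {θ : ℕ} (q : Fin θ → Fin θ → kˣ) (hq : ∀ i, q i i ≠ 1) (t : Fin θ → G) :
    Function.Injective (ColorDouble.incl β q t) ∧
    ∃ Φ : (ColorDouble.FreeAb (Fin θ) →* G) ≃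
        {π : ColorDouble.U β q t →ₐc[k] MonoidAlgebra k G //
          π.comp (ColorDouble.incl β q t) = BialgHom.id k (MonoidAlgebra k G)},
      ∀ ϖ : ColorDouble.FreeAb (Fin θ) →* G,
        (∀ s : G, (Φ ϖ).1 (ColorDouble.elt β q t s) = MonoidAlgebra.of k G s) ∧
        (∀ i, (Φ ϖ).1 (ColorDouble.K β q t i) =
          MonoidAlgebra.of k G (ϖ (ColorDouble.basisElt i))) ∧
        (∀ i, (Φ ϖ).1 (ColorDouble.L β q t i) =
          MonoidAlgebra.of k G (t i * ϖ (ColorDouble.basisElt i) *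
            (ColorDouble.chiOEquiv β hβ).symm (ColorDouble.chi β (t i)))) ∧
        (∀ i, (Φ ϖ).1 (ColorDouble.E β q t i) = 0) ∧
        (∀ i, (Φ ϖ).1 (ColorDouble.F β q t i) = 0) := by
  have he (s : G) : ColorDouble.chiOEquiv β hβ s = ColorDouble.chiO β s := rfl
  have hχ : Function.Surjective (ColorDouble.chiO β) := (ColorDouble.chiOEquiv β hβ).surjective
  have hcomp (ϖ) := ColorDouble.retraction_comp_incl β q t ϖ he
  refine ⟨?_, Equiv.ofBijective (fun ϖ => ⟨ColorDouble.retraction β q t ϖ he, hcomp ϖ⟩)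
    ⟨fun ϖ ϖ' h => ?_, fun ⟨π, hπ⟩ => ?_⟩, fun ϖ => ⟨?_, ?_, ?_, ?_, ?_⟩⟩
  · exact Function.LeftInverse.injective (g := ColorDouble.retraction β q t 1 he)
      (DFunLike.congr_fun (hcomp 1))
  · refine ColorDouble.freeAb_hom_ext fun i => MonoidAlgebra.of_injective (R := k) ?_
    rw [← ColorDouble.retraction_K β q t ϖ he i, ← ColorDouble.retraction_K β q t ϖ' he i]
    exact DFunLike.congr_fun (congrArg Subtype.val h) _
  · obtain ⟨ϖ, hϖ⟩ := ColorDouble.exists_hom_of_retraction π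
    refine ⟨ϖ, Subtype.ext ?_⟩
    have h : (ColorDouble.retraction β q t ϖ he : ColorDouble.U β q t →ₐ[k] MonoidAlgebra k G) =
        (π : ColorDouble.U β q t →ₐ[k] MonoidAlgebra k G) := by
      refine ColorDouble.algHom_ext_of_commRing hχ hq (fun s => ?_) fun i => ?_
      · exact (ColorDouble.retraction_elt β q t ϖ he s).trans
          (ColorDouble.map_elt_of_retraction hπ s).symm
      · exact (ColorDouble.retraction_K β q t ϖ he i).trans (hϖ i).symm
    exact BialgHom.coe_toAlgHom_injective h
  · exact ColorDouble.retraction_elt β q t ϖ he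
  · exact ColorDouble.retraction_K β q t ϖ he
  · exact ColorDouble.retraction_L β q t ϖ he
  · exact fun i => ColorDouble.map_E_eq_zero
      (ColorDouble.retraction β q t ϖ he : ColorDouble.U β q t →ₐ[k] MonoidAlgebra k G) (hq i)
  · exact fun i => ColorDouble.map_F_eq_zero
      (ColorDouble.retraction β q t ϖ he : ColorDouble.U β q t →ₐ[k] MonoidAlgebra k G) (hq i)
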